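/- Let $K=(K_0,K_1,\dots)$ be a real-valued stochastic process on a probability space $(\Omega,\mathcal F,P)$ with $K_0=1$ (a test wealth process), and let $c_t=K_t-K_{t-1}$, $t\ge 1$, be its cash flow increments. Assume that $P$ is the null measure, that is, $K$ is a martingale under $P$ with respect to its natural filtration, and that $\mathbb{E}(c_t^2)<\infty$ for every $t\ge 1$. Suppose that, as $T\to\infty$, $$\frac1T\sum_{t=1}^{T}\mathbb{E}\big(c_t^2\mid c_1,\dots,c_{t-1}\big)\xrightarrow{\;p\;}\sigma^2$$ for a constant $0<\sigma^2<\infty$, and that for every $\epsilon>0$, $$\frac1T\sum_{t=1}^{T}\mathbb{E}\big(c_t^2\,\mathbf 1[\,|c_t|>\epsilon\sqrt T\,]\mid c_1,\dots,c_{t-1}\big)\xrightarrow{\;p\;}0 .$$ Then $$\frac{1}{\sqrt T}\sum_{t=1}^{T}c_t\xrightarrow{\;d\;}N(0,\sigma^2)\qquad(T\to\infty).$$ -/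

import Mathlib

open MeasureTheory ProbabilityTheory Filter Topology
open scoped NNReal

/-- A test wealth process: a real-valued stochastic process `K₀, K₁, …` with `K₀ = 1`. -/
structure IsTestWealthProcess {Ω : Type*} [MeasurableSpace Ω] (K : ℕ → Ω → ℝ) : Prop where
  measurable : ∀ t, Measurable (K t)
  init : ∀ ω, K 0 ω = 1

/-- The natural filtration `t ↦ σ(K₀, …, K_t)` of a test wealth process. -/
noncomputable def IsTestWealthProcess.filtration {Ω : Type*} [mΩ : MeasurableSpace Ω]
    {K : ℕ → Ω → ℝ} (hK : IsTestWealthProcess K) : Filtration ℕ mΩ :=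
  Filtration.natural K (fun t => (hK.measurable t).stronglyMeasurable)

/-- The cash flow increments `c_t = K_t - K_{t-1}`; they are only used for `t ≥ 1`. -/
def cashFlow {Ω : Type*} (K : ℕ → Ω → ℝ) (t : ℕ) (ω : Ω) : ℝ :=
  K t ω - K (t - 1) ω

/-- The σ-algebra generated by the earlier increments `c_1, …, c_{t-1}` (trivial for `t = 1`). -/
@[reducible] def cashFlowPast {Ω : Type*} (K : ℕ → Ω → ℝ) (t : ℕ) : MeasurableSpace Ω :=
  ⨆ s ∈ Set.Ico 1 t, MeasurableSpace.comap (cashFlow K s) inferInstance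

/-! The proof compares characteristic functions. Let `S` be the sum of martingale differences `X t`
and `V` the sum of their conditional variances `v t`. Since `v t` is known one step ahead, passing
from one partial product of exp(iuS + u²V/2) to the next amounts to replacing exp(-u² v/2) by
exp(iuX) against a factor measurable with respect to the past. The conditional expectations of the
two agree to second order, so only Taylor remainders survive, and truncated second moments control
these (`norm_integral_mul_cexp_sub_le`). Telescoping gives E exp(iuS + u²V/2) ≈ 1 as long as `V` is
bounded (`norm_integral_cexp_sum_sub_one_le`).

Boundedness is forced by predictable stopping: `X t` is kept only while the variance accumulated up
to and including time `t` is at most `C`. This preserves the martingale difference property and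
changes nothing where `V ≤ C`. As `V` tends in probability to `s < C`, that event has probability
tending to one and exp(u²V/2) may be replaced there by exp(u²s/2)
(`norm_exp_mul_integral_cexp_sum_sub_one_le`). Lévy's continuity theorem finishes the array version,
which is then applied to the increments divided by √T. -/

/-! ### Taylor remainders of the exponential -/

theorem norm_cexp_mul_I_taylor_two_le_cube {x : ℝ} (hx : |x| ≤ 1) :
    ‖Complex.exp (x * Complex.I) - 1 - x * Complex.I + x ^ 2 / 2‖ ≤ 3 * |x| ^ 3 := by
  have h := Complex.norm_exp_sub_sum_le_norm_mul_exp (x * Complex.I) 3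
  have hs : ∑ m ∈ Finset.range 3, ((x : ℂ) * Complex.I) ^ m / (m.factorial : ℂ)
      = 1 + x * Complex.I - x ^ 2 / 2 := by
    simp [Finset.sum_range_succ, mul_pow]
    ring
  have hn : ‖(x : ℂ) * Complex.I‖ = |x| := by simp
  rw [hs, hn] at h
  have he : Real.exp |x| ≤ 3 :=
    (Real.exp_le_exp.2 hx).trans (Real.exp_one_lt_d9.le.trans (by norm_num))
  calc _ = ‖Complex.exp (x * Complex.I) - (1 + x * Complex.I - x ^ 2 / 2)‖ := by
        congr 1; ring
    _ ≤ |x| ^ 3 * Real.exp |x| := h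
    _ ≤ |x| ^ 3 * 3 := by gcongr
    _ = _ := by ring

/-- Complements the cubic bound: it needs no smallness of `x`, so it handles the large jumps, whose
squares the Lindeberg condition controls. -/
theorem norm_cexp_mul_I_taylor_two_le_sq (x : ℝ) :
    ‖Complex.exp (x * Complex.I) - 1 - x * Complex.I + x ^ 2 / 2‖ ≤ 4 * x ^ 2 := by
  rcases le_or_gt |x| 1 with hx | hx
  · refine (norm_cexp_mul_I_taylor_two_le_cube hx).trans ?_
    rw [← sq_abs x]
    nlinarith [mul_nonneg (sq_nonneg |x|) (sub_nonneg.2 hx), sq_nonneg |x|]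
  · have h1 : ‖Complex.exp (x * Complex.I)‖ = 1 := Complex.norm_exp_ofReal_mul_I x
    have h2 : ‖(x : ℂ) * Complex.I‖ = |x| := by simp
    have h3 : ‖(x : ℂ) ^ 2 / 2‖ = |x| ^ 2 / 2 := by simp
    calc _ ≤ ‖Complex.exp (x * Complex.I)‖ + ‖(1 : ℂ)‖ + ‖(x : ℂ) * Complex.I‖
          + ‖(x : ℂ) ^ 2 / 2‖ :=
          (norm_add_le _ _).trans (add_le_add_left ((norm_sub_le _ _).trans
            (add_le_add_left (norm_sub_le _ _) _)) _)
      _ ≤ 4 * x ^ 2 := by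
          rw [h1, h2, h3, norm_one, ← sq_abs x]
          nlinarith

theorem abs_exp_neg_sub_one_add_le_sq {a : ℝ} (ha : 0 ≤ a) :
    |Real.exp (-a) - 1 + a| ≤ a ^ 2 := by
  rcases le_or_gt a 1 with h | h
  · have := Real.abs_exp_sub_one_sub_id_le (x := -a) (by rwa [abs_neg, abs_of_nonneg ha])
    simpa using this
  · have h0 := Real.exp_pos (-a)
    have h1 : Real.exp (-a) ≤ 1 := Real.exp_le_one_iff.2 (by linarith)
    rw [abs_of_nonneg (by linarith)]
    nlinarith

/-! ### Replacing a single increment -/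

section OneStep

variable {Ω : Type*} {m mΩ : MeasurableSpace Ω} {P : Measure Ω} [IsProbabilityMeasure P]

theorem integral_smul_eq_zero_of_condExp_eq_zero (hm : m ≤ mΩ) {W : Ω → ℂ}
    (hW : StronglyMeasurable[m] W) {M : ℝ} (hM : ∀ ω, ‖W ω‖ ≤ M) {f : Ω → ℝ}
    (hf : Integrable f P) (h0 : P[f | m] =ᵐ[P] 0) :
    ∫ ω, f ω • W ω ∂P = 0 := by
  have h := condExp_stronglyMeasurable_bilin_of_bound
    (ContinuousLinearMap.lsmul ℝ ℝ (E := ℂ)).flip hm hW hf M (ae_of_all P hM)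
  rw [← integral_condExp hm]
  refine integral_eq_zero_of_ae ?_
  filter_upwards [h, h0] with ω h1 h2
  simpa [h2] using h1

/-- One step of the Lindeberg-type comparison: replacing `exp (i u X)` by its conditional Gaussian
counterpart `exp (-u² v / 2)`, where `v` is the conditional variance of `X`. -/
theorem norm_integral_mul_cexp_sub_le (hm : m ≤ mΩ) {W : Ω → ℂ}
    (hW : StronglyMeasurable[m] W) {M : ℝ} (hM : ∀ ω, ‖W ω‖ ≤ M) {X v : Ω → ℝ}
    (hX : MemLp X 2 P) (hX0 : P[X | m] =ᵐ[P] 0) (hvm : StronglyMeasurable[m] v)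
    (hv : v =ᵐ[P] P[fun ω => X ω ^ 2 | m]) {C : ℝ} (hv0 : ∀ ω, 0 ≤ v ω) (hvC : ∀ ω, v ω ≤ C)
    {u ε : ℝ} (hε : 0 ≤ ε) (huε : |u| * ε ≤ 1) :
    ‖∫ ω, W ω * (Complex.exp ((u * X ω : ℝ) * Complex.I) - Real.exp (-(u ^ 2 * v ω / 2))) ∂P‖ ≤
      M * (4 * u ^ 2 * ∫ ω, {ω | ε < |X ω|}.indicator (fun ω => X ω ^ 2) ω ∂P
        + 3 * |u| ^ 3 * ε * ∫ ω, v ω ∂P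
        + u ^ 4 / 4 * (ε ^ 2 * ∫ ω, v ω ∂P
          + C * ∫ ω, {ω | ε < |X ω|}.indicator (fun ω => X ω ^ 2) ω ∂P)) := by
  set I : Ω → ℝ := {ω | ε < |X ω|}.indicator (fun ω => X ω ^ 2) with hI
  set l : Ω → ℝ := P[I | m] with hl
  have hX1 : Integrable X P := hX.integrable (by norm_num)
  have hX2 : Integrable (fun ω => X ω ^ 2) P := hX.integrable_sq
  have hset : NullMeasurableSet {ω | ε < |X ω|} P :=
    nullMeasurableSet_lt aemeasurable_const hX.aestronglyMeasurable.aemeasurable.abs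
  have hIi : Integrable I P := hX2.indicator₀ hset
  have hvi : Integrable v P := integrable_condExp.congr hv.symm
  have hv2 : ∫ ω, X ω ^ 2 ∂P = ∫ ω, v ω ∂P := by
    rw [integral_congr_ae hv, integral_condExp hm]
  have hlI : ∫ ω, l ω ∂P = ∫ ω, I ω ∂P := integral_condExp hm
  have hI0 : ∀ ω, 0 ≤ I ω := fun ω => Set.indicator_nonneg (fun _ _ => sq_nonneg _) ω
  have hXI : ∀ ω, X ω ^ 2 ≤ ε ^ 2 + I ω := by
    intro ω
    by_cases h : ε < |X ω|
    · have : I ω = X ω ^ 2 := Set.indicator_of_mem (s := {ω | ε < |X ω|}) h _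
      rw [this]; nlinarith [sq_nonneg ε]
    · have : X ω ^ 2 ≤ ε ^ 2 := by
        rw [← sq_abs]; exact pow_le_pow_left₀ (abs_nonneg _) (not_lt.1 h) 2
      linarith [hI0 ω]
  have hl0 : 0 ≤ᵐ[P] l := condExp_nonneg (ae_of_all _ hI0)
  -- With `v ≤ C` this gives v² ≤ ε²v + C l, so the quadratic error in exp(-u²v/2) sums to something
  -- small.
  have hvl : ∀ᵐ ω ∂P, v ω ≤ ε ^ 2 + l ω := by
    have h1 : P[fun ω => X ω ^ 2 | m] ≤ᵐ[P] P[(fun _ => ε ^ 2) + I | m] :=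
      condExp_mono hX2 ((integrable_const _).add hIi) (ae_of_all _ hXI)
    have h2 := condExp_add (integrable_const (ε ^ 2)) hIi m (μ := P)
    rw [condExp_const hm] at h2
    filter_upwards [h1, h2, hv] with ω a b c
    rw [c]; exact a.trans (by rw [b]; rfl)
  have hM0 : 0 ≤ M := (norm_nonneg _).trans (hM (Classical.choice (P.nonempty_of_neZero)))
  have hWm : AEStronglyMeasurable W P := (hW.mono hm).aestronglyMeasurable
  have hWX : ∫ ω, X ω • W ω ∂P = 0 := integral_smul_eq_zero_of_condExp_eq_zero hm hW hM hX1 hX0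
  have hWV : ∫ ω, (X ω ^ 2 - v ω) • W ω ∂P = 0 := by
    refine integral_smul_eq_zero_of_condExp_eq_zero hm hW hM (hX2.sub hvi) ?_
    have h1 := condExp_sub hX2 hvi m
    rw [condExp_of_stronglyMeasurable hm hvm hvi] at h1
    filter_upwards [h1, hv] with ω a b
    exact a.trans (by simp [b])
  have iWX : Integrable (fun ω => X ω • W ω) P := by
    refine (hX1.norm.mul_const M).mono' (hX1.aestronglyMeasurable.smul hWm) (ae_of_all _ fun ω => ?_)
    rw [norm_smul]; exact mul_le_mul_of_nonneg_left (hM ω) (norm_nonneg _)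
  have iWV : Integrable (fun ω => (X ω ^ 2 - v ω) • W ω) P := by
    have := hX2.sub hvi
    refine (this.norm.mul_const M).mono' (this.aestronglyMeasurable.smul hWm)
      (ae_of_all _ fun ω => ?_)
    rw [norm_smul]; exact mul_le_mul_of_nonneg_left (hM ω) (norm_nonneg _)
  -- The terms removed from the two exponentials differ by a multiple of `X` and a multiple of `X² -
  -- v`. Both integrate to zero against `W`, by `hWX` and `hWV`.
  set R : Ω → ℂ := fun ω => Complex.exp ((u * X ω : ℝ) * Complex.I) - 1
    - (u * X ω : ℝ) * Complex.I + ((u * X ω : ℝ) : ℂ) ^ 2 / 2 with hR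
  set r : Ω → ℝ := fun ω => Real.exp (-(u ^ 2 * v ω / 2)) - 1 + u ^ 2 * v ω / 2 with hr
  have key : ∀ ω, W ω * (R ω - r ω) =
      W ω * (Complex.exp ((u * X ω : ℝ) * Complex.I) - Real.exp (-(u ^ 2 * v ω / 2)))
      - ((u * Complex.I) * (X ω • W ω) - (u ^ 2 / 2 : ℂ) * ((X ω ^ 2 - v ω) • W ω)) := by
    intro ω
    simp only [hR, hr, Complex.real_smul]
    push_cast
    ring
  have hXm : AEMeasurable X P := hX.aestronglyMeasurable.aemeasurable
  have hvmm : Measurable v := hvm.measurable.mono hm le_rfl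
  have iE : Integrable (fun ω => W ω *
      (Complex.exp ((u * X ω : ℝ) * Complex.I) - Real.exp (-(u ^ 2 * v ω / 2)))) P := by
    refine Integrable.of_bound (C := M * 2) (hWm.mul ?_) (ae_of_all _ fun ω => ?_)
    · refine AEMeasurable.aestronglyMeasurable ?_
      fun_prop
    · rw [norm_mul]
      refine mul_le_mul (hM ω) ?_ (norm_nonneg _) hM0
      refine (norm_sub_le _ _).trans ?_
      rw [Complex.norm_exp_ofReal_mul_I, Complex.norm_real, Real.norm_eq_abs, Real.abs_exp]
      have : Real.exp (-(u ^ 2 * v ω / 2)) ≤ 1 :=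
        Real.exp_le_one_iff.2 (by have := mul_nonneg (sq_nonneg u) (hv0 ω); linarith)
      linarith
  have hint : ∫ ω, W ω * (R ω - r ω) ∂P = ∫ ω, W ω *
      (Complex.exp ((u * X ω : ℝ) * Complex.I) - Real.exp (-(u ^ 2 * v ω / 2))) ∂P := by
    simp_rw [key]
    have j1 : Integrable (fun ω => (u * Complex.I) * (X ω • W ω)) P := iWX.const_mul _
    have j2 : Integrable (fun ω => (u ^ 2 / 2 : ℂ) * ((X ω ^ 2 - v ω) • W ω)) P :=
      iWV.const_mul _
    have j3 : Integrable (fun ω => (u * Complex.I) * (X ω • W ω)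
      - (u ^ 2 / 2 : ℂ) * ((X ω ^ 2 - v ω) • W ω)) P := j1.sub j2
    rw [integral_sub iE j3, integral_sub j1 j2, integral_const_mul, integral_const_mul, hWX, hWV]
    simp
  rw [← hint]
  have hbound : ∀ᵐ ω ∂P, ‖W ω * (R ω - r ω)‖ ≤ M * (4 * u ^ 2 * I ω
      + 3 * |u| ^ 3 * ε * X ω ^ 2 + u ^ 4 / 4 * (ε ^ 2 * v ω + C * l ω)) := by
    filter_upwards [hvl, hl0] with ω h1 h2
    rw [norm_mul]
    refine mul_le_mul (hM ω) ?_ (norm_nonneg _) hM0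
    refine (norm_sub_le _ _).trans (add_le_add ?_ ?_)
    · by_cases h : ε < |X ω|
      · have hIx : I ω = X ω ^ 2 := Set.indicator_of_mem (s := {ω | ε < |X ω|}) h _
        refine (norm_cexp_mul_I_taylor_two_le_sq (u * X ω)).trans ?_
        rw [hIx]
        have : 0 ≤ 3 * |u| ^ 3 * ε * X ω ^ 2 := by positivity
        nlinarith
      · rw [not_lt] at h
        have hb : |u * X ω| ≤ |u| * ε := by rw [abs_mul]; gcongr
        refine (norm_cexp_mul_I_taylor_two_le_cube (hb.trans huε)).trans ?_
        have e : 3 * |u * X ω| ^ 3 = 3 * |u| ^ 3 * |X ω| * X ω ^ 2 := by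
          rw [abs_mul, ← sq_abs (X ω)]; ring
        rw [e]
        have : 3 * |u| ^ 3 * |X ω| * X ω ^ 2 ≤ 3 * |u| ^ 3 * ε * X ω ^ 2 := by gcongr
        have h3 : 0 ≤ 4 * u ^ 2 * I ω := mul_nonneg (by positivity) (hI0 ω)
        linarith
    · rw [Complex.norm_real, Real.norm_eq_abs]
      have h3 := mul_nonneg (sq_nonneg u) (hv0 ω)
      refine (abs_exp_neg_sub_one_add_le_sq (a := u ^ 2 * v ω / 2) (by linarith)).trans ?_
      have e : (u ^ 2 * v ω / 2) ^ 2 = u ^ 4 / 4 * (v ω * v ω) := by ring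
      rw [e]
      refine mul_le_mul_of_nonneg_left ?_ (by positivity)
      have h4 := mul_le_mul_of_nonneg_left h1 (hv0 ω)
      have h5 := mul_le_mul_of_nonneg_right (hvC ω) h2
      nlinarith
  have hli : Integrable l P := integrable_condExp
  have i1 : Integrable (fun ω => 4 * u ^ 2 * I ω) P := hIi.const_mul _
  have i2 : Integrable (fun ω => 3 * |u| ^ 3 * ε * X ω ^ 2) P := hX2.const_mul _
  have i3 : Integrable (fun ω => ε ^ 2 * v ω) P := hvi.const_mul _
  have i4 : Integrable (fun ω => C * l ω) P := hli.const_mul _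
  have i12 : Integrable (fun ω => 4 * u ^ 2 * I ω + 3 * |u| ^ 3 * ε * X ω ^ 2) P := i1.add i2
  have i34 : Integrable (fun ω => u ^ 4 / 4 * (ε ^ 2 * v ω + C * l ω)) P :=
    (i3.add i4).const_mul _
  refine (norm_integral_le_of_norm_le ((i12.add i34).const_mul M) hbound).trans_eq ?_
  rw [integral_const_mul, integral_add' i12 i34, integral_add i1 i2, integral_const_mul (u ^ 4 / 4),
    integral_add i3 i4]
  simp only [integral_const_mul]
  rw [hv2, hlI]

end OneStep

/-! ### Telescoping along a row with bounded total variance -/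

section Row

variable {Ω : Type*} {mΩ : MeasurableSpace Ω} {P : Measure Ω} [IsProbabilityMeasure P]

/-- For a martingale difference sequence `X` whose sum of conditional variances `v` is bounded by
`C`, the exponential `exp (i u ∑ X + u² / 2 ∑ v)` has expectation close to `1`. -/
theorem norm_integral_cexp_sum_sub_one_le (𝓖 : Filtration ℕ mΩ) {X v : ℕ → Ω → ℝ}
    (hXm : ∀ t, StronglyMeasurable[𝓖 (t + 1)] (X t)) (hX : ∀ t, MemLp (X t) 2 P)
    (hX0 : ∀ t, P[X t | 𝓖 t] =ᵐ[P] 0) (hvm : ∀ t, StronglyMeasurable[𝓖 t] (v t))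
    (hv : ∀ t, v t =ᵐ[P] P[fun ω => X t ω ^ 2 | 𝓖 t]) (hv0 : ∀ t ω, 0 ≤ v t ω) {C : ℝ}
    (hvC : ∀ n ω, ∑ t ∈ Finset.range n, v t ω ≤ C)
    {u ε : ℝ} (hε : 0 ≤ ε) (huε : |u| * ε ≤ 1) (n : ℕ) :
    ‖∫ ω, Complex.exp ((u * ∑ t ∈ Finset.range n, X t ω : ℝ) * Complex.I)
        * Real.exp (u ^ 2 * (∑ t ∈ Finset.range n, v t ω) / 2) ∂P - 1‖ ≤
      Real.exp (u ^ 2 * C / 2) *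
        (4 * u ^ 2 * ∑ t ∈ Finset.range n,
            ∫ ω, {ω | ε < |X t ω|}.indicator (fun ω => X t ω ^ 2) ω ∂P
          + 3 * |u| ^ 3 * ε * C
          + u ^ 4 / 4 * (ε ^ 2 * C + C * ∑ t ∈ Finset.range n,
            ∫ ω, {ω | ε < |X t ω|}.indicator (fun ω => X t ω ^ 2) ω ∂P)) := by
  set M := Real.exp (u ^ 2 * C / 2) with hM
  set δ : ℕ → ℝ := fun t => ∫ ω, {ω | ε < |X t ω|}.indicator (fun ω => X t ω ^ 2) ω ∂P with hδ
  have hvC1 : ∀ t ω, v t ω ≤ C := fun t ω =>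
    (Finset.single_le_sum (fun s _ => hv0 s ω) (Finset.self_mem_range_succ t)).trans
      (hvC (t + 1) ω)
  have hvi : ∀ t, Integrable (v t) P := fun t => integrable_condExp.congr (hv t).symm
  have hSm : ∀ n, StronglyMeasurable[𝓖 n] (fun ω => ∑ t ∈ Finset.range n, X t ω) := fun n =>
    Finset.stronglyMeasurable_fun_sum _ fun t ht =>
      (hXm t).mono (𝓖.mono (Finset.mem_range.1 ht))
  have hVm : ∀ n, StronglyMeasurable[𝓖 n] (fun ω => ∑ t ∈ Finset.range (n + 1), v t ω) := fun n =>
    Finset.stronglyMeasurable_fun_sum _ fun t ht =>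
      (hvm t).mono (𝓖.mono (Nat.lt_succ_iff.1 (Finset.mem_range.1 ht)))
  have hexp : ∀ x : ℝ, x ≤ C → Real.exp (u ^ 2 * x / 2) ≤ M := fun x hx => by
    rw [hM]; gcongr
  have hnorm : ∀ x y : ℝ, y ≤ C →
      ‖Complex.exp ((u * x : ℝ) * Complex.I) * Real.exp (u ^ 2 * y / 2)‖ ≤ M := fun x y hy => by
    rw [norm_mul, Complex.norm_exp_ofReal_mul_I, one_mul, Complex.norm_real, Real.norm_eq_abs,
      Real.abs_exp]
    exact hexp y hy
  set Z : ℕ → Ω → ℂ := fun n ω => Complex.exp ((u * ∑ t ∈ Finset.range n, X t ω : ℝ) * Complex.I)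
        * Real.exp (u ^ 2 * (∑ t ∈ Finset.range n, v t ω) / 2) with hZ
  have hZi : ∀ n, Integrable (Z n) P := fun n => by
    refine Integrable.of_bound (C := M) (AEMeasurable.aestronglyMeasurable ?_)
      (ae_of_all _ fun ω => hnorm _ _ (hvC n ω))
    have h1 : Measurable (fun ω => ∑ t ∈ Finset.range n, X t ω) :=
      (hSm n).measurable.mono (𝓖.le n) le_rfl
    have h2 : Measurable (fun ω => ∑ t ∈ Finset.range n, v t ω) :=
      Finset.measurable_fun_sum _ fun t _ => (hvm t).measurable.mono (𝓖.le t) le_rfl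
    fun_prop
  have hstep : ∀ n, ‖∫ ω, Z (n + 1) ω ∂P - ∫ ω, Z n ω ∂P‖ ≤
      M * (4 * u ^ 2 * δ n + 3 * |u| ^ 3 * ε * ∫ ω, v n ω ∂P
        + u ^ 4 / 4 * (ε ^ 2 * ∫ ω, v n ω ∂P + C * δ n)) := fun n => by
    -- The variance sum runs one index further than the sum of the `X t`. By predictability `W` is
    -- still `𝓖 n`-measurable, and it is the common factor of `Z (n + 1)` and `Z n`.
    set W : Ω → ℂ := fun ω => Complex.exp ((u * ∑ t ∈ Finset.range n, X t ω : ℝ) * Complex.I)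
        * Real.exp (u ^ 2 * (∑ t ∈ Finset.range (n + 1), v t ω) / 2) with hW
    have hWm : StronglyMeasurable[𝓖 n] W := by
      have h1 : Measurable[𝓖 n] (fun ω => ∑ t ∈ Finset.range n, X t ω) := (hSm n).measurable
      have h2 : Measurable[𝓖 n] (fun ω => ∑ t ∈ Finset.range (n + 1), v t ω) := (hVm n).measurable
      have h3 : Measurable[𝓖 n] W := by fun_prop
      exact h3.stronglyMeasurable
    have hdiff : ∀ ω, Z (n + 1) ω - Z n ω =
        W ω * (Complex.exp ((u * X n ω : ℝ) * Complex.I) - Real.exp (-(u ^ 2 * v n ω / 2))) := by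
      intro ω
      simp only [hZ, hW, Finset.sum_range_succ]
      rw [mul_sub]
      congr 1
      · rw [mul_add u, Complex.ofReal_add, add_mul, Complex.exp_add]; ring
      · rw [mul_assoc, ← Complex.ofReal_mul, ← Real.exp_add]
        congr 3; ring
    rw [← integral_sub (hZi _) (hZi _)]
    simp_rw [hdiff]
    exact norm_integral_mul_cexp_sub_le (𝓖.le n) hWm (fun ω => hnorm _ _ (hvC _ ω)) (hX n) (hX0 n)
      (hvm n) (hv n) (hv0 n) (hvC1 n) hε huε
  have htel : ∀ n, ‖∫ ω, Z n ω ∂P - 1‖ ≤ ∑ k ∈ Finset.range n,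
      M * (4 * u ^ 2 * δ k + 3 * |u| ^ 3 * ε * ∫ ω, v k ω ∂P
        + u ^ 4 / 4 * (ε ^ 2 * ∫ ω, v k ω ∂P + C * δ k)) := fun n => by
    induction n with
    | zero => simp [hZ]
    | succ n ih =>
      rw [Finset.sum_range_succ]
      calc _ = ‖(∫ ω, Z (n + 1) ω ∂P - ∫ ω, Z n ω ∂P) + (∫ ω, Z n ω ∂P - 1)‖ := by
            congr 1; ring
        _ ≤ _ :=
            (norm_add_le _ _).trans ((add_le_add (hstep n) ih).trans_eq (add_comm _ _))
  have hVC : ∑ k ∈ Finset.range n, ∫ ω, v k ω ∂P ≤ C := by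
    rw [← integral_finsetSum _ (fun k _ => hvi k)]
    calc _ ≤ ∫ _, C ∂P := integral_mono (integrable_finsetSum _ fun k _ => hvi k)
          (integrable_const _) (hvC n)
      _ = C := by simp
  refine (htel n).trans ?_
  rw [← Finset.mul_sum]
  refine mul_le_mul_of_nonneg_left ?_ (Real.exp_pos _).le
  simp only [Finset.sum_add_distrib, ← Finset.mul_sum]
  gcongr

end Row

/-! ### Stopping at a variance level -/

section Truncation

variable {Ω : Type*} {mΩ : MeasurableSpace Ω} {P : Measure Ω} [IsProbabilityMeasure P]

/-- Every subsequence has a further one converging almost everywhere, to which dominated convergence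
applies. Continuity is asked only at `c` because `truncatedVarianceError` may jump at the level `C`.
-/
theorem MeasureTheory.TendstoInMeasure.tendsto_integral_comp {f : ℕ → Ω → ℝ} {c : ℝ}
    (hf : TendstoInMeasure P f atTop (fun _ => c)) (hfm : ∀ n, AEStronglyMeasurable (f n) P)
    {φ : ℝ → ℝ} (hφ : Measurable φ) (hc : ContinuousAt φ c) {M : ℝ} (hM : ∀ x, |φ x| ≤ M) :
    Tendsto (fun n => ∫ ω, φ (f n ω) ∂P) atTop (𝓝 (φ c)) := by
  refine tendsto_of_subseq_tendsto fun ns hns => ?_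
  obtain ⟨ms, -, hms⟩ := (hf.comp hns).exists_seq_tendsto_ae
  refine ⟨ms, ?_⟩
  have h : Tendsto (fun n => ∫ ω, φ (f (ns (ms n)) ω) ∂P) atTop (𝓝 (∫ _, φ c ∂P)) := by
    refine tendsto_integral_of_dominated_convergence (fun _ => M) (fun n => ?_)
      (integrable_const _) (fun n => ae_of_all _ fun ω => hM _) ?_
    · exact (hφ.comp_aemeasurable (hfm _).aemeasurable).aestronglyMeasurable
    · filter_upwards [hms] with ω hω
      exact hc.tendsto.comp hω
  simpa using h

/-- The error made in replacing the limiting variance `s` by the random variance `x`, after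
truncating at level `C`. -/
noncomputable def truncatedVarianceError (u s C x : ℝ) : ℝ :=
  if x ≤ C then |Real.exp (u ^ 2 * s / 2) - Real.exp (u ^ 2 * x / 2)|
  else 2 * Real.exp (u ^ 2 * C / 2)

theorem measurable_truncatedVarianceError (u s C : ℝ) :
    Measurable (truncatedVarianceError u s C) := by
  refine Measurable.ite measurableSet_Iic ?_ measurable_const
  fun_prop

theorem abs_truncatedVarianceError_le {u s C : ℝ} (hs : s ≤ C) (x : ℝ) :
    |truncatedVarianceError u s C x| ≤ 2 * Real.exp (u ^ 2 * C / 2) := by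
  unfold truncatedVarianceError
  split_ifs with h
  · rw [abs_abs]
    refine (abs_sub _ _).trans ?_
    rw [Real.abs_exp, Real.abs_exp, two_mul]
    gcongr
  · rw [abs_of_pos (by positivity)]

theorem continuousAt_truncatedVarianceError {u s C : ℝ} (hs : s < C) :
    ContinuousAt (truncatedVarianceError u s C) s := by
  have h : ContinuousAt (fun x => |Real.exp (u ^ 2 * s / 2) - Real.exp (u ^ 2 * x / 2)|) s := by
    fun_prop
  refine h.congr ?_
  filter_upwards [Iic_mem_nhds hs] with x hx
  exact (if_pos hx).symm

theorem truncatedVarianceError_self {u s C : ℝ} (hs : s ≤ C) :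
    truncatedVarianceError u s C s = 0 := by
  simp [truncatedVarianceError, hs]

/-- The first integral is the cost of stopping and of exchanging the random variance for `s`; the
rest is the row estimate for the stopped sequence. Both integrands depending on conditional
expectations are bounded, so convergence in probability will suffice to make them vanish. -/
theorem norm_exp_mul_integral_cexp_sum_sub_one_le (𝓖 : Filtration ℕ mΩ) {X : ℕ → Ω → ℝ}
    (hXm : ∀ t, StronglyMeasurable[𝓖 (t + 1)] (X t)) (hX : ∀ t, MemLp (X t) 2 P)
    (hX0 : ∀ t, P[X t | 𝓖 t] =ᵐ[P] 0) {s C : ℝ} (hs : s ≤ C) (hC : 0 ≤ C)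
    {u ε : ℝ} (hε : 0 ≤ ε) (huε : |u| * ε ≤ 1) (n : ℕ) :
    ‖Real.exp (u ^ 2 * s / 2) *
        ∫ ω, Complex.exp ((u * ∑ t ∈ Finset.range n, X t ω : ℝ) * Complex.I) ∂P - 1‖ ≤
      ∫ ω, truncatedVarianceError u s C
          (∑ t ∈ Finset.range n, (P[fun ω => X t ω ^ 2 | 𝓖 t]) ω) ∂P +
      Real.exp (u ^ 2 * C / 2) *
        (4 * u ^ 2 * ∫ ω, min C |∑ t ∈ Finset.range n,
            (P[{ω | ε < |X t ω|}.indicator (fun ω => X t ω ^ 2) | 𝓖 t]) ω| ∂P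
          + 3 * |u| ^ 3 * ε * C
          + u ^ 4 / 4 * (ε ^ 2 * C + C * ∫ ω, min C |∑ t ∈ Finset.range n,
            (P[{ω | ε < |X t ω|}.indicator (fun ω => X t ω ^ 2) | 𝓖 t]) ω| ∂P)) := by
  set p : ℕ → Ω → ℝ := fun t => P[fun ω => X t ω ^ 2 | 𝓖 t] with hp
  set I : ℕ → Ω → ℝ := fun t => {ω | ε < |X t ω|}.indicator (fun ω => X t ω ^ 2) with hI
  set l : ℕ → Ω → ℝ := fun t => P[I t | 𝓖 t] with hl
  -- A conditional expectation is nonnegative only almost everywhere; this version is so everywhere,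
  -- which makes the variance bound below hold pointwise and the events `A t` decreasing in `t`.
  set q : ℕ → Ω → ℝ := fun t ω => max 0 (p t ω) with hq
  have hX2 : ∀ t, Integrable (fun ω => X t ω ^ 2) P := fun t => (hX t).integrable_sq
  have hpm : ∀ t, Measurable[𝓖 t] (p t) := fun t => stronglyMeasurable_condExp.measurable
  have hqm : ∀ t, Measurable[𝓖 t] (q t) := fun t => measurable_const.max (hpm t)
  have hq0 : ∀ t ω, 0 ≤ q t ω := fun t ω => le_max_left _ _
  have hpq : ∀ t, p t =ᵐ[P] q t := fun t => by
    have : 0 ≤ᵐ[P] p t := condExp_nonneg (ae_of_all _ fun ω => sq_nonneg _)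
    filter_upwards [this] with ω h
    exact (max_eq_right h).symm
  have hXmm : ∀ t, Measurable (X t) := fun t => (hXm t).measurable.mono (𝓖.le _) le_rfl
  have hIi : ∀ t, Integrable (I t) P := fun t =>
    (hX2 t).indicator (measurableSet_lt measurable_const (hXmm t).abs)
  have hI0 : ∀ t ω, 0 ≤ I t ω := fun t ω => Set.indicator_nonneg (fun _ _ => sq_nonneg _) ω
  have hl0 : ∀ t, 0 ≤ᵐ[P] l t := fun t => condExp_nonneg (ae_of_all _ (hI0 t))
  have hlp : ∀ t, l t ≤ᵐ[P] p t := fun t => condExp_mono (hIi t) (hX2 t)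
    (ae_of_all _ fun ω => Set.indicator_le_self' (fun _ _ => sq_nonneg _) ω)
  -- The sum includes `q t`, so the stopped variance never overshoots `C`, yet the event is `𝓖
  -- t`-measurable and can be taken out of the conditional expectations of `X t` and its square.
  set A : ℕ → Set Ω := fun t => {ω | ∑ r ∈ Finset.range (t + 1), q r ω ≤ C} with hA
  have hAm : ∀ t, MeasurableSet[𝓖 t] (A t) := fun t => by
    have : Measurable[𝓖 t] (fun ω => ∑ r ∈ Finset.range (t + 1), q r ω) :=
      Finset.measurable_fun_sum _ fun r hr =>
        (hqm r).mono (𝓖.mono (Nat.lt_succ_iff.1 (Finset.mem_range.1 hr))) le_rfl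
    exact measurableSet_le this measurable_const
  set Y : ℕ → Ω → ℝ := fun t => (A t).indicator (X t) with hY
  set v : ℕ → Ω → ℝ := fun t => (A t).indicator (q t) with hv
  have hvq : ∀ t ω, v t ω ≤ q t ω := fun t ω => Set.indicator_le_self' (fun _ _ => hq0 t _) ω
  have hvC : ∀ n ω, ∑ t ∈ Finset.range n, v t ω ≤ C := fun n ω => by
    induction n with
    | zero => simpa using hC
    | succ n ih =>
      by_cases h : ω ∈ A n
      · exact (Finset.sum_le_sum fun t _ => hvq t ω).trans h
      · rw [Finset.sum_range_succ, hv]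
        simpa [Set.indicator_of_notMem h] using ih
  have hmem : ∀ ω, ∑ t ∈ Finset.range n, q t ω ≤ C → ∀ t ∈ Finset.range n, ω ∈ A t :=
    fun ω hω t ht => (Finset.sum_le_sum_of_subset_of_nonneg
      (Finset.range_subset_range.2 (Finset.mem_range.1 ht)) fun r _ _ => hq0 r ω).trans hω
  have hYsq : ∀ t, (fun ω => Y t ω ^ 2) = (A t).indicator (fun ω => X t ω ^ 2) := fun t => by
    ext ω
    by_cases h : ω ∈ A t <;> simp [hY, h]
  have hYI : ∀ t, {ω | ε < |Y t ω|}.indicator (fun ω => Y t ω ^ 2) = (A t).indicator (I t) :=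
    fun t => by
      ext ω
      by_cases h : ω ∈ A t <;> simp [hY, hI, h, Set.indicator]
  have hrow := norm_integral_cexp_sum_sub_one_le 𝓖 (P := P) (X := Y) (v := v)
    (fun t => (hXm t).indicator (𝓖.mono t.le_succ _ (hAm t)))
    (fun t => (hX t).indicator (𝓖.le t _ (hAm t)))
    (fun t => by
      filter_upwards [condExp_indicator ((hX t).integrable (by norm_num)) (hAm t), hX0 t]
        with ω h1 h2
      rw [h1, Set.indicator_apply, h2]; simp)
    (fun t => (hqm t).stronglyMeasurable.indicator (hAm t))
    (fun t => by
      rw [hYsq]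
      filter_upwards [condExp_indicator (hX2 t) (hAm t), hpq t] with ω h1 h2
      rw [h1]; simp only [hv, Set.indicator_apply, ← h2, hp])
    (fun t ω => Set.indicator_nonneg (fun _ _ => hq0 t _) ω) hvC hε huε n
  -- After conditioning, the stopped sum of the `l t` is at most the stopped variance, hence at most
  -- `C`, and also at most the unstopped sum; this yields the minimum.
  have hδ : ∑ t ∈ Finset.range n, ∫ ω, {ω | ε < |Y t ω|}.indicator (fun ω => Y t ω ^ 2) ω ∂P ≤
      ∫ ω, min C |∑ t ∈ Finset.range n, l t ω| ∂P := by
    have h1 : ∀ t, ∫ ω, {ω | ε < |Y t ω|}.indicator (fun ω => Y t ω ^ 2) ω ∂P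
        = ∫ ω, (A t).indicator (l t) ω ∂P := fun t => by
      rw [hYI, ← integral_condExp (𝓖.le t)]
      exact integral_congr_ae (condExp_indicator (hIi t) (hAm t))
    have hli : ∀ t, Integrable ((A t).indicator (l t)) P := fun t =>
      integrable_condExp.indicator (𝓖.le t _ (hAm t))
    rw [Finset.sum_congr rfl fun t _ => h1 t, ← integral_finsetSum _ fun t _ => hli t]
    refine integral_mono_ae (integrable_finsetSum _ fun t _ => hli t) ?_ ?_
    · refine Integrable.of_bound (C := C) ?_ (ae_of_all _ fun ω => ?_)
      · have : ∀ t, Measurable (l t) := fun t =>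
          stronglyMeasurable_condExp.measurable.mono (𝓖.le t) le_rfl
        have h2 : Measurable fun ω => ∑ t ∈ Finset.range n, l t ω :=
          Finset.measurable_fun_sum _ fun t _ => this t
        exact (measurable_const.min h2.abs).aestronglyMeasurable
      · rw [Real.norm_eq_abs, abs_of_nonneg (le_min hC (abs_nonneg _))]
        exact min_le_left _ _
    · filter_upwards [ae_all_iff.2 hl0, ae_all_iff.2 hlp, ae_all_iff.2 hpq] with ω a b c
      refine le_min ((Finset.sum_le_sum fun t _ => ?_).trans (hvC n ω))
        ((Finset.sum_le_sum fun t _ => ?_).trans (le_abs_self _))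
      · exact Set.indicator_le_indicator ((b t).trans_eq (c t))
      · exact Set.indicator_apply_le' (fun _ => le_rfl) (fun _ => a t)
  set S : Ω → ℂ := fun ω =>
    Complex.exp ((u * ∑ t ∈ Finset.range n, X t ω : ℝ) * Complex.I) with hS
  set Z : Ω → ℂ := fun ω => Complex.exp ((u * ∑ t ∈ Finset.range n, Y t ω : ℝ) * Complex.I)
    * Real.exp (u ^ 2 * (∑ t ∈ Finset.range n, v t ω) / 2) with hZ
  have hSi : Integrable S P := by
    refine Integrable.of_bound (C := 1) (Measurable.aestronglyMeasurable ?_)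
      (ae_of_all _ fun ω => (Complex.norm_exp_ofReal_mul_I _).le)
    fun_prop
  have hZn : ∀ ω, ‖Z ω‖ ≤ Real.exp (u ^ 2 * C / 2) := fun ω => by
    rw [norm_mul, Complex.norm_exp_ofReal_mul_I, one_mul, Complex.norm_real, Real.norm_eq_abs,
      Real.abs_exp]
    have := hvC n ω
    gcongr
  have hZi : Integrable Z P := by
    refine Integrable.of_bound (Measurable.aestronglyMeasurable ?_) _ (ae_of_all _ hZn)
    have h1 : ∀ t, Measurable (Y t) := fun t => (hXmm t).indicator (𝓖.le t _ (hAm t))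
    have h2 : ∀ t, Measurable (v t) := fun t =>
      ((hqm t).mono (𝓖.le t) le_rfl).indicator (𝓖.le t _ (hAm t))
    fun_prop
  have hcmp : ‖∫ ω, (Real.exp (u ^ 2 * s / 2) * S ω - Z ω) ∂P‖ ≤
      ∫ ω, truncatedVarianceError u s C (∑ t ∈ Finset.range n, p t ω) ∂P := by
    refine norm_integral_le_of_norm_le ?_ ?_
    · refine Integrable.of_bound (Measurable.aestronglyMeasurable ?_) _
        (ae_of_all _ fun ω => abs_truncatedVarianceError_le hs _)
      refine (measurable_truncatedVarianceError u s C).comp ?_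
      exact Finset.measurable_fun_sum _ fun t _ => (hpm t).mono (𝓖.le t) le_rfl
    · filter_upwards [ae_all_iff.2 hpq] with ω hω
      rw [Finset.sum_congr rfl fun t _ => hω t]
      unfold truncatedVarianceError
      split_ifs with h
      · have e1 : ∑ t ∈ Finset.range n, Y t ω = ∑ t ∈ Finset.range n, X t ω :=
          Finset.sum_congr rfl fun t ht => Set.indicator_of_mem (hmem ω h t ht) _
        have e2 : ∑ t ∈ Finset.range n, v t ω = ∑ t ∈ Finset.range n, q t ω :=
          Finset.sum_congr rfl fun t ht => Set.indicator_of_mem (hmem ω h t ht) _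
        simp only [hS, hZ]
        rw [e1, e2, mul_comm, ← mul_sub, norm_mul, Complex.norm_exp_ofReal_mul_I, one_mul,
          ← Complex.ofReal_sub, Complex.norm_real, Real.norm_eq_abs]
      · refine (norm_sub_le _ _).trans ?_
        rw [two_mul]
        refine add_le_add ?_ (hZn ω)
        rw [norm_mul, Complex.norm_exp_ofReal_mul_I, mul_one, Complex.norm_real, Real.norm_eq_abs,
          Real.abs_exp]
        gcongr
  rw [integral_sub (hSi.const_mul _) hZi, integral_const_mul] at hcmp
  calc _ = ‖(Real.exp (u ^ 2 * s / 2) * ∫ ω, S ω ∂P - ∫ ω, Z ω ∂P) + (∫ ω, Z ω ∂P - 1)‖ := by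
        congr 1; ring
    _ ≤ _ := norm_add_le _ _
    _ ≤ _ := by
        refine add_le_add hcmp (hrow.trans ?_)
        gcongr

end Truncation

/-! ### Central limit theorem for martingale difference arrays -/

section CentralLimit

variable {Ω : Type*} {mΩ : MeasurableSpace Ω} {P : Measure Ω} [IsProbabilityMeasure P]

theorem tendsto_integral_cexp_sum_of_martingale_difference_array (𝓖 : ℕ → Filtration ℕ mΩ)
    {X : ℕ → ℕ → Ω → ℝ} (hXm : ∀ n t, StronglyMeasurable[𝓖 n (t + 1)] (X n t))
    (hX : ∀ n t, MemLp (X n t) 2 P) (hX0 : ∀ n t, P[X n t | 𝓖 n t] =ᵐ[P] 0) {s : ℝ} (hs : 0 ≤ s)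
    (hvar : TendstoInMeasure P
      (fun n ω => ∑ t ∈ Finset.range n, (P[fun ω => X n t ω ^ 2 | 𝓖 n t]) ω) atTop (fun _ => s))
    (hlind : ∀ ε : ℝ, 0 < ε → TendstoInMeasure P
      (fun n ω => ∑ t ∈ Finset.range n,
        (P[{ω | ε < |X n t ω|}.indicator (fun ω => X n t ω ^ 2) | 𝓖 n t]) ω) atTop (fun _ => 0))
    (u : ℝ) :
    Tendsto (fun n => ∫ ω, Complex.exp ((u * ∑ t ∈ Finset.range n, X n t ω : ℝ) * Complex.I) ∂P)
      atTop (𝓝 (Real.exp (-(u ^ 2 * s / 2)) : ℝ)) := by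
  -- Any level strictly above `s` would do; strictness gives continuity of the truncated error at
  -- `s`.
  set C := s + 1 with hCdef
  have hC : 0 ≤ C := by linarith
  have hsC : s < C := by linarith
  set M := Real.exp (u ^ 2 * C / 2) with hMdef
  have hsum : ∀ (f : ℕ → ℕ → Ω → ℝ) n, AEStronglyMeasurable
      (fun ω => ∑ t ∈ Finset.range n, (P[f n t | 𝓖 n t]) ω) P := fun f n =>
    (Finset.measurable_fun_sum _ fun t _ =>
      (stronglyMeasurable_condExp.measurable.mono ((𝓖 n).le t) le_rfl)).aestronglyMeasurable
  have hD := hvar.tendsto_integral_comp (hsum _) (measurable_truncatedVarianceError u s C)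
    (continuousAt_truncatedVarianceError hsC) (abs_truncatedVarianceError_le hsC.le)
  rw [truncatedVarianceError_self hsC.le] at hD
  have hE : ∀ ε : ℝ, 0 < ε → Tendsto (fun n => ∫ ω, min C |∑ t ∈ Finset.range n,
      (P[{ω | ε < |X n t ω|}.indicator (fun ω => X n t ω ^ 2) | 𝓖 n t]) ω| ∂P) atTop (𝓝 0) := by
    intro ε hε
    have h := (hlind ε hε).tendsto_integral_comp (hsum _) (φ := fun x => min C |x|) (M := C)
      (by fun_prop) (by fun_prop)
      (fun x => by rw [abs_of_nonneg (le_min hC (abs_nonneg _))]; exact min_le_left _ _)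
    simpa [hC] using h
  set Φ : ℕ → ℂ := fun n =>
    ∫ ω, Complex.exp ((u * ∑ t ∈ Finset.range n, X n t ω : ℝ) * Complex.I) ∂P with hΦ
  have key : Tendsto (fun n => (Real.exp (u ^ 2 * s / 2) : ℂ) * Φ n) atTop (𝓝 1) := by
    rw [Metric.tendsto_atTop']
    intro η hη
    have hg : Tendsto (fun ε : ℝ => M * (3 * |u| ^ 3 * ε * C + u ^ 4 / 4 * (ε ^ 2 * C)))
        (𝓝[>] 0) (𝓝 0) := by
      have : Continuous fun ε : ℝ => M * (3 * |u| ^ 3 * ε * C + u ^ 4 / 4 * (ε ^ 2 * C)) := by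
        fun_prop
      simpa using (this.tendsto 0).mono_left nhdsWithin_le_nhds
    have hg' : Tendsto (fun ε : ℝ => |u| * ε) (𝓝[>] 0) (𝓝 0) := by
      have : Continuous fun ε : ℝ => |u| * ε := by fun_prop
      simpa using (this.tendsto 0).mono_left nhdsWithin_le_nhds
    -- Here ε is fixed before `n` grows: the terms of the bound that do not vanish in the limit are
    -- those of `hg`, already below `η`.
    obtain ⟨ε, ⟨h1, h2⟩, h3⟩ := ((hg.eventually_lt_const hη).and
      (hg'.eventually_lt_const one_pos)).and self_mem_nhdsWithin |>.exists
    have hε : 0 < ε := h3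
    have hlim := hD.add ((((hE ε hε).const_mul (4 * u ^ 2)).add_const (3 * |u| ^ 3 * ε * C)).add
      ((((hE ε hε).const_mul C).const_add (ε ^ 2 * C)).const_mul (u ^ 4 / 4)) |>.const_mul M)
    have hlt := hlim.eventually_lt_const (u := η) (by simpa using h1)
    obtain ⟨N, hN⟩ := eventually_atTop.1 hlt
    refine ⟨N, fun n hn => ?_⟩
    rw [dist_eq_norm]
    exact (norm_exp_mul_integral_cexp_sum_sub_one_le (𝓖 n) (hXm n) (hX n) (hX0 n) hsC.le hC hε.le
      h2.le n).trans_lt (hN n hn.le)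
  have := key.const_mul (Real.exp (-(u ^ 2 * s / 2)) : ℂ)
  simpa only [← mul_assoc, ← Complex.ofReal_mul, ← Real.exp_add, neg_add_cancel, Real.exp_zero,
    Complex.ofReal_one, one_mul, mul_one] using this

/-- **Martingale central limit theorem** for arrays: if the conditional variances of the rows sum up
to `s` in probability and the conditional Lindeberg condition holds, then the row sums converge in
distribution to the centered Gaussian of variance `s`. -/
theorem tendstoInDistribution_sum_of_martingale_difference_array (𝓖 : ℕ → Filtration ℕ mΩ)
    {X : ℕ → ℕ → Ω → ℝ} (hXm : ∀ n t, StronglyMeasurable[𝓖 n (t + 1)] (X n t))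
    (hX : ∀ n t, MemLp (X n t) 2 P) (hX0 : ∀ n t, P[X n t | 𝓖 n t] =ᵐ[P] 0) {s : ℝ≥0}
    (hvar : TendstoInMeasure P
      (fun n ω => ∑ t ∈ Finset.range n, (P[fun ω => X n t ω ^ 2 | 𝓖 n t]) ω) atTop
      (fun _ => (s : ℝ)))
    (hlind : ∀ ε : ℝ, 0 < ε → TendstoInMeasure P
      (fun n ω => ∑ t ∈ Finset.range n,
        (P[{ω | ε < |X n t ω|}.indicator (fun ω => X n t ω ^ 2) | 𝓖 n t]) ω) atTop
      (fun _ => 0)) :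
    TendstoInDistribution (fun n ω => ∑ t ∈ Finset.range n, X n t ω)
      atTop (id : ℝ → ℝ) (fun _ => P) (gaussianReal 0 s) := by
  have hm : ∀ n, AEMeasurable (fun ω => ∑ t ∈ Finset.range n, X n t ω) P := fun n =>
    Finset.aemeasurable_fun_sum _ fun t _ => (hX n t).aestronglyMeasurable.aemeasurable
  refine ⟨hm, aemeasurable_id, ProbabilityMeasure.tendsto_iff_tendsto_charFun.2 fun u => ?_⟩
  have h := tendsto_integral_cexp_sum_of_martingale_difference_array 𝓖 hXm hX hX0
    s.coe_nonneg hvar hlind u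
  simp only [ProbabilityMeasure.coe_mk, Measure.map_id, charFun_gaussianReal]
  convert h using 2 with n
  · rw [charFun_apply_real, integral_map (hm n) (by fun_prop)]
    simp
  · push_cast
    congr 1
    ring

end CentralLimit

/-! ### Cash flows as martingale differences -/

section CashFlow

variable {Ω : Type*} [mΩ : MeasurableSpace Ω] {P : Measure Ω} [IsProbabilityMeasure P]
  {K : ℕ → Ω → ℝ}

theorem IsTestWealthProcess.measurable_cashFlow (hK : IsTestWealthProcess K) (t : ℕ) :
    Measurable (cashFlow K t) :=
  (hK.measurable t).sub (hK.measurable (t - 1))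

/-- The filtration `t ↦ σ(c₁, …, c_t)` of the increments of a test wealth process. -/
def IsTestWealthProcess.cashFlowFiltration (hK : IsTestWealthProcess K) : Filtration ℕ mΩ where
  seq t := cashFlowPast K (t + 1)
  mono' _ _ h := biSup_mono fun _ hr => ⟨hr.1, hr.2.trans_le (Nat.succ_le_succ h)⟩
  le' _ := iSup₂_le fun r _ => (hK.measurable_cashFlow r).comap_le

theorem IsTestWealthProcess.cashFlowFiltration_apply (hK : IsTestWealthProcess K) (t : ℕ) :
    hK.cashFlowFiltration t = cashFlowPast K (t + 1) := rfl

theorem IsTestWealthProcess.stronglyMeasurable_cashFlow (hK : IsTestWealthProcess K) (t : ℕ) :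
    StronglyMeasurable[hK.cashFlowFiltration (t + 1)] (cashFlow K (t + 1)) := by
  refine Measurable.stronglyMeasurable ?_
  rw [measurable_iff_comap_le, hK.cashFlowFiltration_apply]
  exact le_biSup (fun r => MeasurableSpace.comap (cashFlow K r) inferInstance)
    (show t + 1 ∈ Set.Ico 1 (t + 1 + 1) by simp)

theorem IsTestWealthProcess.cashFlowFiltration_le (hK : IsTestWealthProcess K) (t : ℕ) :
    hK.cashFlowFiltration t ≤ hK.filtration t := by
  have hm : ∀ r ≤ t, Measurable[hK.filtration t] (K r) := fun r hr =>
    ((Filtration.stronglyAdapted_natural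
      (fun t => (hK.measurable t).stronglyMeasurable) r).mono (hK.filtration.mono hr)).measurable
  refine iSup₂_le fun r hr => measurable_iff_comap_le.1 ?_
  exact (hm r (Nat.lt_succ_iff.1 hr.2)).sub (hm (r - 1) (by have := hr.2; omega))

/-- The martingale property concerns the filtration of `K`; the tower property carries it down to
the smaller one generated by the increments. -/
theorem IsTestWealthProcess.condExp_cashFlow (hK : IsTestWealthProcess K)
    (hnull : Martingale K hK.filtration P) (t : ℕ) :
    P[cashFlow K (t + 1) | hK.cashFlowFiltration t] =ᵐ[P] 0 := by
  have h0 : P[cashFlow K (t + 1) | hK.filtration t] =ᵐ[P] 0 := by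
    have h1 : P[K (t + 1) - K t | hK.filtration t] =ᵐ[P] _ :=
      condExp_sub (hnull.integrable (t + 1)) (hnull.integrable t) (hK.filtration t)
    filter_upwards [h1, hnull.condExp_ae_eq t.le_succ, hnull.condExp_ae_eq (le_refl t)]
      with ω a b c
    exact a.trans (by simp [b, c])
  refine (condExp_condExp_of_le (hK.cashFlowFiltration_le t) (hK.filtration.le t)).symm.trans ?_
  exact (condExp_congr_ae h0).trans (by rw [condExp_zero])

theorem Finset.sum_Icc_one_eq_sum_range_add_one {M : Type*} [AddCommMonoid M] (f : ℕ → M) (n : ℕ) :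
    ∑ t ∈ Finset.Icc 1 n, f t = ∑ t ∈ Finset.range n, f (t + 1) := by
  rw [Finset.range_eq_Ico, Finset.sum_Ico_add' f 0 n 1]
  rfl

end CashFlow

theorem theorem2 {Ω : Type*} [MeasurableSpace Ω] (P : Measure Ω) [IsProbabilityMeasure P]
    (K : ℕ → Ω → ℝ) (hK : IsTestWealthProcess K)
    (hnull : Martingale K hK.filtration P)
    (hL2 : ∀ t, 1 ≤ t → MemLp (cashFlow K t) 2 P)
    (σsq : ℝ≥0) (hσ : 0 < σsq)
    (hvar : TendstoInMeasure P
      (fun (T : ℕ) ω => (T : ℝ)⁻¹ * ∑ t ∈ Finset.Icc 1 T,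
        (P[fun ω' => cashFlow K t ω' ^ 2 | cashFlowPast K t]) ω)
      atTop (fun _ => (σsq : ℝ)))
    (hlind : ∀ ε : ℝ, 0 < ε → TendstoInMeasure P
      (fun (T : ℕ) ω => (T : ℝ)⁻¹ * ∑ t ∈ Finset.Icc 1 T,
        (P[Set.indicator {ω' | ε * √(T : ℝ) < |cashFlow K t ω'|}
            (fun ω' => cashFlow K t ω' ^ 2) | cashFlowPast K t]) ω)
      atTop (fun _ => (0 : ℝ))) :
    TendstoInDistribution
      (fun (T : ℕ) ω => (√(T : ℝ))⁻¹ * ∑ t ∈ Finset.Icc 1 T, cashFlow K t ω)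
      atTop (id : ℝ → ℝ) (fun _ => P) (gaussianReal 0 σsq) := by
  simp only [Finset.sum_Icc_one_eq_sum_range_add_one, Finset.mul_sum] at hvar hlind ⊢
  have hsq : ∀ (n t : ℕ), (fun ω => ((√(n : ℝ))⁻¹ * cashFlow K (t + 1) ω) ^ 2)
      = (n : ℝ)⁻¹ • fun ω => cashFlow K (t + 1) ω ^ 2 := fun n t => by
    ext ω
    simp [mul_pow, Real.sq_sqrt]
  refine tendstoInDistribution_sum_of_martingale_difference_array
    (fun _ => hK.cashFlowFiltration)
    -- Entry `t` carries the increment of index `t + 1`, and `hK.cashFlowFiltration t` is by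
    -- definition `cashFlowPast K (t + 1)`, so the conditioning matches the hypotheses.
    (X := fun n t ω => (√(n : ℝ))⁻¹ * cashFlow K (t + 1) ω)
    (fun n t => (hK.stronglyMeasurable_cashFlow t).const_mul _)
    (fun n t => (hL2 (t + 1) (Nat.le_add_left 1 t)).const_mul _) (fun n t => ?_) ?_
    (fun ε hε => ?_)
  · refine (condExp_smul (√(n : ℝ))⁻¹ (cashFlow K (t + 1)) (hK.cashFlowFiltration t)).trans ?_
    filter_upwards [hK.condExp_cashFlow hnull t] with ω h
    simp [h]
  · refine hvar.congr_left fun n => ?_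
    have h : ∀ t, P[fun ω => ((√(n : ℝ))⁻¹ * cashFlow K (t + 1) ω) ^ 2 | hK.cashFlowFiltration t]
        =ᵐ[P] (n : ℝ)⁻¹ • P[fun ω => cashFlow K (t + 1) ω ^ 2 | hK.cashFlowFiltration t] :=
      fun t => by rw [hsq]; exact condExp_smul _ _ _
    filter_upwards [ae_all_iff.2 h] with ω hω
    exact Finset.sum_congr rfl fun t _ => (hω t).symm
  · refine (hlind ε hε).congr' ?_ EventuallyEq.rfl
    -- Moving √n across the threshold inequality needs n > 0; the variance identity above also holds
    -- at n = 0, where both scalings are zero.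
    filter_upwards [eventually_gt_atTop 0] with n hn
    have hn' : 0 < √(n : ℝ) := Real.sqrt_pos.2 (Nat.cast_pos.2 hn)
    have hset : ∀ t, {ω | ε < |(√(n : ℝ))⁻¹ * cashFlow K (t + 1) ω|}
        = {ω | ε * √(n : ℝ) < |cashFlow K (t + 1) ω|} := fun t => by
      ext ω
      simp only [Set.mem_ofPred_eq]
      rw [abs_mul, abs_of_pos (inv_pos.2 hn'), ← div_eq_inv_mul, lt_div_iff₀ hn']
    have h : ∀ t, P[{ω | ε < |(√(n : ℝ))⁻¹ * cashFlow K (t + 1) ω|}.indicator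
          (fun ω => ((√(n : ℝ))⁻¹ * cashFlow K (t + 1) ω) ^ 2) | hK.cashFlowFiltration t]
        =ᵐ[P] (n : ℝ)⁻¹ • P[{ω | ε * √(n : ℝ) < |cashFlow K (t + 1) ω|}.indicator
          (fun ω => cashFlow K (t + 1) ω ^ 2) | hK.cashFlowFiltration t] := fun t => by
      
      rw [hsq, hset]
      exact (condExp_congr_ae (EventuallyEq.of_eq (Set.indicator_const_smul _ _ _))).trans
        (condExp_smul (n : ℝ)⁻¹ _ _)
    filter_upwards [ae_all_iff.2 h] with ω hω
    exact Finset.sum_congr rfl fun t _ => (hω t).symm
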